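/- Let $H(\mathbb{C})$ be the space of entire functions with the topology of local uniform convergence, and for $a\in\mathbb{C}$ let $T_a:H(\mathbb{C})\to H(\mathbb{C})$ be the translation operator $T_a(f)(z)=f(z+a)$. For a sequence $(T_n)$ of continuous linear operators on $H(\mathbb{C})$, let $HC(\{T_n\})$ be the set of all $f\in H(\mathbb{C})$ such that $\{T_n f : n\ge 1\}$ is dense in $H(\mathbb{C})$ (the hypercyclic vectors of $(T_n)$). Let $(\lambda_n)_{n\ge 1}$ be a sequence of non-zero complex numbers with $|\lambda_n|\to+\infty$ such that for every $M>0$ there is a subsequence $(\mu_n)$ of $(\lambda_n)$ satisfying (i) $|\mu_{n+1}|-|\mu_n|>M$ for every $n\ge 1$, and (ii) $\sum_{n=1}^{\infty}\frac{1}{|\mu_n|}=+\infty$. Let $r_0,R_0,\theta_0,\theta_T$ be real numbers with $0<r_0<1<R_0<+\infty$, $0\le\theta_0<\theta_T\le 1$ and $\theta_T-\theta_0=\frac14$, and let $$S=\{re^{2\pi i t} : r\in[r_0,R_0],\ t\in[\theta_0,\theta_T]\}.$$ Then $\bigcap_{a\in S}HC(\{T_{\lambda_n a}\})$ is a $G_\delta$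 and dense subset of $H(\mathbb{C})$. -/

import Mathlib

open Filter Topology

/-- The space `H(ℂ)` of entire functions, as a subspace of the space `C(ℂ, ℂ)` of continuous
functions. The latter carries the compact-open topology, so `H(ℂ)` has the topology of uniform
convergence on compact sets, which is the topology of local uniform convergence. -/
def entireFunctions : Submodule ℂ C(ℂ, ℂ) where
  carrier := {f | Differentiable ℂ (f : ℂ → ℂ)}
  add_mem' hf hg := Differentiable.add hf hg
  zero_mem' := differentiable_const (0 : ℂ)
  smul_mem' c _ hf := Differentiable.const_smul hf c

/-- The translation operator `T_a : H(ℂ) → H(ℂ)`, `(T_a f)(z) = f (z + a)`, a continuous linear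
operator. -/
noncomputable def translation (a : ℂ) : entireFunctions →L[ℂ] entireFunctions where
  toFun f := ⟨(f : C(ℂ, ℂ)).comp ⟨fun z => z + a, by fun_prop⟩,
    Differentiable.comp (g := (f : C(ℂ, ℂ))) f.2 (differentiable_id.add_const a)⟩
  map_add' _ _ := rfl
  map_smul' _ _ := rfl
  cont := ((ContinuousMap.continuous_precomp _).comp continuous_subtype_val).subtype_mk _

@[simp]
theorem translation_apply (a : ℂ) (f : entireFunctions) (z : ℂ) :
    (translation a f : C(ℂ, ℂ)) z = (f : C(ℂ, ℂ)) (z + a) := rfl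

/-- The set `HC({T_n})` of hypercyclic vectors of a sequence of continuous linear operators: the
vectors `x` whose orbit `{T_n x : n}` is dense. -/
def hypercyclicVectors {X : Type*} [AddCommMonoid X] [Module ℂ X] [TopologicalSpace X]
    (T : ℕ → X →L[ℂ] X) : Set X :=
  {x | Dense (Set.range fun n => T n x)}

/-- Condition `(Σ)`: for every `M > 0` there is a subsequence `μ_n = l (φ n)` of `l` with
`|μ_{n+1}| - |μ_n| > M` for all `n` and `∑ 1 / |μ_n| = +∞`. -/
def ConditionSigma (l : ℕ → ℂ) : Prop :=
  ∀ M : ℝ, 0 < M → ∃ φ : ℕ → ℕ, StrictMono φ ∧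
    (∀ n, M < ‖l (φ (n + 1))‖ - ‖l (φ n)‖) ∧
    Tendsto (fun N => ∑ n ∈ Finset.range N, 1 / ‖l (φ n)‖) atTop atTop

/-- The closed sector `{r e^{2πit} : r ∈ [r₀, R₀], t ∈ [θ₀, θT]}`. -/
def sector (r₀ R₀ θ₀ θT : ℝ) : Set ℂ :=
  {a | ∃ r ∈ Set.Icc r₀ R₀, ∃ t ∈ Set.Icc θ₀ θT,
    a = (r : ℂ) * Complex.exp (2 * Real.pi * Complex.I * t)}

/-! The intersection over `S` equals a countable intersection of sets `hittingSet l S U`, `U` in a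
countable basis. Each is open because `S` is compact and translation is jointly continuous, so by
Baire it suffices that each is dense. For density, take `g` to be perturbed and `p ∈ U`. Suppose
finitely many pairs `(n, c)` have points `l n * c` far from each other and from 0, while the discs
of radius `δ / ‖l n‖` about the `c` cover `S`. Runge approximation on disjoint discs gives an entire
function near `g` around 0 and near the shift of `p` around each `l n * c`. If `a` lies in the small
disc of `c`, then `l n * a` is within `δ` of `l n * c`, so uniform continuity of `p` puts the
translate in `U`. The difficulty is the cover (`exists_sector_cover`): cycling through blocks of `q`
indices separates points on one circle, and divergence of `∑ 1 / ‖μ_n‖` lets the radii cross `[r₀,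
R₀]` in finitely many steps. -/

/-! ### Connectedness of the complement of separated discs -/

theorem isPreconnected_annulus (c : ℂ) {a b : ℝ} (ha : 0 ≤ a) :
    IsPreconnected {z : ℂ | a < ‖z - c‖ ∧ ‖z - c‖ < b} := by
  have h : {z : ℂ | a < ‖z - c‖ ∧ ‖z - c‖ < b} =
      (fun p : ℝ × ℝ => c + p.1 * Complex.exp (p.2 * Complex.I)) ''
        (Set.Ioo a b ×ˢ Set.univ) := by
    ext z
    constructor
    · rintro ⟨h1, h2⟩
      refine ⟨(‖z - c‖, Complex.arg (z - c)), ⟨⟨h1, h2⟩, trivial⟩, ?_⟩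
      simp only [Complex.norm_mul_exp_arg_mul_I]
      ring
    · rintro ⟨⟨r, t⟩, ⟨⟨h1, h2⟩, -⟩, rfl⟩
      have hr : 0 ≤ r := ha.trans h1.le
      simp only at h1 h2
      simp [Complex.norm_exp_ofReal_mul_I, abs_of_nonneg hr, h1, h2]
  rw [h]
  exact (isPreconnected_Ioo.prod isPreconnected_univ).image _ (by fun_prop)

/-- The annulus around the removed disc is connected, so it lies on one side of any separation;
filling the hole on that side would separate `U`. -/
theorem IsPreconnected.diff_closedBall {U : Set ℂ} (hU : IsPreconnected U) {c : ℂ} {ρ ρ' : ℝ}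
    (hρ : 0 ≤ ρ) (hsub : Metric.ball c ρ' ⊆ U) (hlt : ρ < ρ') :
    IsPreconnected (U \ Metric.closedBall c ρ) := by
  have hA := isPreconnected_annulus c (b := ρ') hρ
  set A := {z : ℂ | ρ < ‖z - c‖ ∧ ‖z - c‖ < ρ'}
  have hAU : A ⊆ U \ Metric.closedBall c ρ := fun z hz =>
    ⟨hsub (by simpa [dist_eq_norm] using hz.2), by simpa [dist_eq_norm] using hz.1⟩
  have key : ∀ u v : Set ℂ, IsOpen u → IsOpen v → U \ Metric.closedBall c ρ ⊆ u ∪ v →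
      (U \ Metric.closedBall c ρ) ∩ (u ∩ v) = ∅ → A ⊆ u →
      U \ Metric.closedBall c ρ ⊆ u ∨ U \ Metric.closedBall c ρ ⊆ v := by
    intro u v hu hv huv hdis hAu
    have hD : IsOpen (Metric.closedBall c ρ)ᶜ := Metric.isClosed_closedBall.isOpen_compl
    have hmem : ∀ z, z ∈ Metric.ball c ρ' → z ∉ Metric.closedBall c ρ → z ∈ u := fun z h1 h2 =>
      hAu ⟨by simpa [dist_eq_norm] using h2, by simpa [dist_eq_norm] using h1⟩
    have hcov : U ⊆ (u ∩ (Metric.closedBall c ρ)ᶜ ∪ Metric.ball c ρ') ∪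
        v ∩ (Metric.closedBall c ρ)ᶜ := by
      intro z hz
      by_cases hzD : z ∈ Metric.closedBall c ρ
      · exact Or.inl (Or.inr (Metric.closedBall_subset_ball hlt hzD))
      · rcases huv ⟨hz, hzD⟩ with h | h
        · exact Or.inl (Or.inl ⟨h, hzD⟩)
        · exact Or.inr ⟨h, hzD⟩
    have hdis' : U ∩ ((u ∩ (Metric.closedBall c ρ)ᶜ ∪ Metric.ball c ρ') ∩
        (v ∩ (Metric.closedBall c ρ)ᶜ)) = ∅ := by
      refine Set.eq_empty_of_forall_notMem ?_
      rintro z ⟨hz, h1, h2⟩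
      refine Set.eq_empty_iff_forall_notMem.1 hdis z ⟨⟨hz, h2.2⟩, ?_, h2.1⟩
      rcases h1 with h1 | h1
      · exact h1.1
      · exact hmem z h1 h2.2
    rcases isPreconnected_iff_subset_of_disjoint.1 hU _ _
      ((hu.inter hD).union Metric.isOpen_ball) (hv.inter hD) hcov hdis' with h | h
    · left
      intro z hz
      rcases h hz.1 with h | h
      · exact h.1
      · exact hmem z h hz.2
    · right
      exact fun z hz => (h hz.1).1
  rw [isPreconnected_iff_subset_of_disjoint]
  intro u v hu hv huv hdis
  have hAdis : A ∩ (u ∩ v) = ∅ :=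
    Set.subset_eq_empty (Set.inter_subset_inter_left _ hAU) hdis
  rcases isPreconnected_iff_subset_of_disjoint.1 hA u v hu hv (hAU.trans huv) hAdis with h | h
  · exact key u v hu hv huv hdis h
  · exact (key v u hv hu (by rwa [Set.union_comm]) (by rwa [Set.inter_comm v u]) h).symm

theorem isPreconnected_compl_biUnion_closedBall {ρ L : ℝ} (hρ : 0 ≤ ρ) (hL : 2 * ρ < L)
    (C : Finset ℂ) (hC : (C : Set ℂ).Pairwise fun c c' => L ≤ dist c c') :
    IsPreconnected (⋃ c ∈ C, Metric.closedBall c ρ)ᶜ := by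
  induction C using Finset.induction_on with
  | empty => simpa using isPreconnected_univ
  | insert c C hc ih =>
    have hC' := hC.mono (Finset.coe_subset.2 (Finset.subset_insert c C))
    rw [Finset.set_biUnion_insert, Set.compl_union, Set.inter_comm, ← Set.sdiff_eq]
    refine (ih hC').diff_closedBall (ρ' := L - ρ) hρ ?_ (by linarith)
    intro z hz
    simp only [Set.mem_compl_iff, Set.mem_iUnion, not_exists]
    intro c' hc' hz'
    have h1 : L ≤ dist c c' := hC (by simp) (by simp [hc']) (by rintro rfl; exact hc hc')
    rw [Metric.mem_ball] at hz
    rw [Metric.mem_closedBall] at hz'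
    have := dist_triangle_left c c' z
    linarith

/-! ### Runge approximation by spectral permanence -/

/-- The entire functions as a subalgebra of `C(ℂ, ℂ)`. -/
def entireSubalgebra : Subalgebra ℂ C(ℂ, ℂ) where
  carrier := {f | Differentiable ℂ (f : ℂ → ℂ)}
  mul_mem' hf hg := Differentiable.mul hf hg
  add_mem' hf hg := Differentiable.add hf hg
  algebraMap_mem' c := differentiable_const c

/-- The uniform closure in `C(K, ℂ)` of the restrictions of entire functions. -/
noncomputable def entireClosure (K : Set ℂ) [CompactSpace K] : Subalgebra ℂ C(K, ℂ) :=
  (entireSubalgebra.map (ContinuousMap.compRightAlgHom ℂ ℂ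
    (⟨Subtype.val, continuous_subtype_val⟩ : C(K, ℂ)))).topologicalClosure

theorem restrict_mem_entireClosure {K : Set ℂ} [CompactSpace K] {f : C(ℂ, ℂ)}
    (hf : Differentiable ℂ f) : f.comp ⟨Subtype.val, continuous_subtype_val⟩ ∈ entireClosure K :=
  Subalgebra.le_topologicalClosure _ ⟨f, hf, rfl⟩

theorem exists_entire_approx {K : Set ℂ} [CompactSpace K] {g : C(K, ℂ)}
    (hg : g ∈ entireClosure K) {ε : ℝ} (hε : 0 < ε) :
    ∃ f : C(ℂ, ℂ), Differentiable ℂ f ∧ ∀ z : K, ‖f z - g z‖ < ε := by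
  have hg' : g ∈ closure (entireSubalgebra.map (ContinuousMap.compRightAlgHom ℂ ℂ
    (⟨Subtype.val, continuous_subtype_val⟩ : C(K, ℂ))) : Set C(K, ℂ)) := hg
  obtain ⟨_, ⟨f, hf, rfl⟩, h⟩ := Metric.mem_closure_iff.1 hg' ε hε
  refine ⟨f, hf, fun z => ?_⟩
  rw [dist_comm] at h
  have := (ContinuousMap.dist_lt_iff hε).1 h z
  simpa [dist_eq_norm] using this

/-- Passing to a closed subalgebra can only fill holes of a spectrum. As `Kᶜ` is connected, the
coordinate function keeps spectrum `K` in the closure, and spectral mapping makes `q` of it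
invertible there. -/
theorem exists_inv_mem_entireClosure {K : Set ℂ} [CompactSpace K] (hK : K.Nonempty)
    (hconn : IsPreconnected Kᶜ) (q : Polynomial ℂ) (hq : ∀ z ∈ K, q.eval z ≠ 0) :
    ∃ y ∈ entireClosure K, ∀ z : K, y z = (q.eval (z : ℂ))⁻¹ := by
  let x : entireClosure K := ⟨_, restrict_mem_entireClosure (K := K) (f := ContinuousMap.id ℂ)
    differentiable_id⟩
  have hxv : spectrum ℂ (x : C(K, ℂ)) = K := by
    rw [ContinuousMap.spectrum_eq_range]
    ext z
    simp [x]
  have : IsClosed (entireClosure K : Set C(K, ℂ)) := Subalgebra.isClosed_topologicalClosure _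
  have hx : spectrum ℂ x = K := by
    rw [Subalgebra.spectrum_eq_of_isPreconnected_compl (entireClosure K) x (by rwa [hxv]), hxv]
  have hunit : IsUnit (Polynomial.aeval x q) := by
    rw [← spectrum.zero_notMem_iff ℂ,
      spectrum.map_polynomial_aeval_of_nonempty x q (by rwa [hx]), hx]
    rintro ⟨z, hz, h0⟩
    exact hq z hz h0
  obtain ⟨y, hy⟩ := hunit.exists_right_inv
  refine ⟨y, y.2, fun z => ?_⟩
  have h1 : ((Polynomial.aeval x q : entireClosure K) : C(K, ℂ)) z = q.eval (z : ℂ) := by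
    simp [x]
  have h3 : ((Polynomial.aeval x q : entireClosure K) : C(K, ℂ)) z * (y : C(K, ℂ)) z = 1 := by
    have := congrArg (fun w : entireClosure K => (w : C(K, ℂ)) z) hy
    simpa using this
  rw [h1] at h3
  exact eq_inv_of_mul_eq_one_right h3

/-- The function `1 / (1 - w)` with `w = ((z - c) / s) ^ N` works: `ρ < s < L - ρ`, so for large
`N`, `w` is tiny on the disc of `c` and huge on the others. -/
theorem exists_approx_indicator {ρ L : ℝ} (hρ : 0 < ρ) (hL : 2 * ρ < L) {C : Finset ℂ}
    (hC : (C : Set ℂ).Pairwise fun c c' => L ≤ dist c c') {K : Set ℂ} [CompactSpace K]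
    (hK : K = ⋃ c ∈ C, Metric.closedBall c ρ) {c : ℂ} (hc : c ∈ C) {η : ℝ} (hη : 0 < η) :
    ∃ y ∈ entireClosure K, ∀ z : K, ((z : ℂ) ∈ Metric.closedBall c ρ → ‖y z - 1‖ ≤ η) ∧
      ((z : ℂ) ∉ Metric.closedBall c ρ → ‖y z‖ ≤ η) := by
  set s := L / 2 with hs
  have hs0 : 0 < s := by linarith
  have ha : ρ / s < 1 := by rw [div_lt_one hs0]; linarith
  have ha0 : 0 ≤ ρ / s := by positivity
  have hb : 1 < (L - ρ) / s := by rw [one_lt_div hs0]; linarith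
  -- The thresholds `η / (1 + η)` and `1 + 1 / η` for `‖w‖` are those giving `‖w / (1 - w)‖ ≤ η` and
  -- `‖1 / (1 - w)‖ ≤ η`.
  have hη1 : 0 < η / (1 + η) := by positivity
  obtain ⟨N, hN1, hN2⟩ := (((tendsto_pow_atTop_nhds_zero_of_lt_one ha0 ha).eventually_le_const
    hη1).and ((tendsto_pow_atTop_atTop_of_one_lt hb).eventually_ge_atTop (1 + 1 / η))).exists
  have hη2 : η / (1 + η) < 1 := by rw [div_lt_one (by positivity)]; linarith
  set w : ℂ → ℂ := fun z => ((z - c) / s) ^ N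
  have hw : ∀ z, ‖w z‖ = (dist z c / s) ^ N := fun z => by
    simp [w, dist_eq_norm, abs_of_pos hs0]
  have hw1 : ∀ z ∈ Metric.closedBall c ρ, ‖w z‖ ≤ η / (1 + η) := fun z hz => by
    rw [hw]
    refine le_trans ?_ hN1
    gcongr
    exact hz
  have hw2 : ∀ z ∈ K, z ∉ Metric.closedBall c ρ → 1 + 1 / η ≤ ‖w z‖ := fun z hz hzc => by
    rw [hw]
    refine hN2.trans ?_
    have : L - ρ ≤ dist z c := by
      rw [hK] at hz
      simp only [Set.mem_iUnion] at hz
      obtain ⟨c', hc', hz⟩ := hz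
      have h1 : L ≤ dist c' c := hC hc' hc (by rintro rfl; exact hzc hz)
      have h2 := dist_triangle_left c' c z
      rw [Metric.mem_closedBall] at hz
      linarith
    have : 0 ≤ L - ρ := by linarith
    gcongr
  have hpos : 0 < 1 / η := by positivity
  have hne : ∀ z ∈ K, ‖w z‖ ≠ 1 := fun z hz => by
    by_cases h : z ∈ Metric.closedBall c ρ
    · exact ((hw1 z h).trans_lt hη2).ne
    · exact (lt_of_lt_of_le (by linarith) (hw2 z hz h)).ne'
  obtain ⟨y, hyS, hy⟩ := exists_inv_mem_entireClosure (K := K)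
    ⟨c, by rw [hK]; exact Set.mem_biUnion hc (Metric.mem_closedBall_self hρ.le)⟩
    (by rw [hK]; exact isPreconnected_compl_biUnion_closedBall hρ.le hL C hC)
    (1 - (Polynomial.C (s : ℂ)⁻¹ * (Polynomial.X - Polynomial.C c)) ^ N) (fun z hz h0 => by
      apply hne z hz
      have : w z = 1 := by
        simp only [Polynomial.eval_sub, Polynomial.eval_one, Polynomial.eval_pow,
          Polynomial.eval_mul, Polynomial.eval_C, Polynomial.eval_X] at h0
        rw [sub_eq_zero] at h0
        simp only [w, div_eq_inv_mul, ← h0]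
      simp [this])
  have hy' : ∀ z : K, y z = (1 - w z)⁻¹ := fun z => by
    rw [hy z]
    simp [w, div_eq_inv_mul]
  refine ⟨y, hyS, fun z => ⟨fun hz => ?_, fun hz => ?_⟩⟩
  · have h1 := hw1 z hz
    have h2 : 1 - w z ≠ 0 := fun h => hne z z.2 (by simp [← sub_eq_zero.1 h])
    have h3 : y z - 1 = w z / (1 - w z) := by rw [hy']; field_simp; ring
    have h4 : 1 - ‖w z‖ ≤ ‖1 - w z‖ := by simpa using norm_sub_norm_le 1 (w z)
    rw [h3, norm_div, div_le_iff₀ (norm_pos_iff.2 h2)]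
    rw [le_div_iff₀ (by positivity)] at h1
    nlinarith
  · have h1 := hw2 z z.2 hz
    have h4 : ‖w z‖ - 1 ≤ ‖1 - w z‖ := by
      rw [norm_sub_rev]; simpa using norm_sub_norm_le (w z) 1
    rw [hy', norm_inv]
    refine inv_le_of_inv_le₀ hη ?_
    rw [one_div] at h1
    linarith

/-- Runge approximation on a finite union of well separated discs of equal radius. -/
theorem exists_entire_approx_on_discs {ρ L : ℝ} (hρ : 0 < ρ) (hL : 2 * ρ < L) {C : Finset ℂ}
    (hC : (C : Set ℂ).Pairwise fun c c' => L ≤ dist c c') (f : ℂ → C(ℂ, ℂ))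
    (hf : ∀ c, Differentiable ℂ (f c)) {ε : ℝ} (hε : 0 < ε) :
    ∃ F : C(ℂ, ℂ), Differentiable ℂ F ∧
      ∀ c ∈ C, ∀ z ∈ Metric.closedBall c ρ, ‖F z - f c z‖ < ε := by
  set K : Set ℂ := ⋃ c ∈ C, Metric.closedBall c ρ with hK
  have hKc : IsCompact K := C.isCompact_biUnion fun c _ => isCompact_closedBall c ρ
  have : CompactSpace K := isCompact_iff_compactSpace.1 hKc
  have hB : ∃ B : ℝ, 0 ≤ B ∧ ∀ c ∈ C, ∀ z ∈ K, ‖f c z‖ ≤ B := by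
    choose b hb using fun c => hKc.exists_bound_of_continuousOn (f c).continuous.continuousOn
    refine ⟨∑ c ∈ C, |b c|, Finset.sum_nonneg fun _ _ => abs_nonneg _, fun c hc z hz => ?_⟩
    exact ((hb c z hz).trans (le_abs_self _)).trans
      (Finset.single_le_sum (f := fun c => |b c|) (fun _ _ => abs_nonneg _) hc)
  obtain ⟨B, hB0, hB⟩ := hB
  -- Each summand below contributes an error at most `B * η`; the `+ 1` keeps the denominator
  -- positive.
  set η := ε / (2 * (C.card * B + 1)) with hηdef
  have hη : 0 < η := by positivity
  have hsmall : C.card * (B * η) < ε / 2 := by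
    rw [hηdef, ← mul_assoc, ← mul_div_assoc, div_lt_div_iff₀ (by positivity) (by positivity)]
    nlinarith
  choose! y hyS hy using fun c (hc : c ∈ C) => exists_approx_indicator hρ hL hC hK hc hη
  obtain ⟨F, hF, hFz⟩ := exists_entire_approx (K := K)
    (g := ∑ c ∈ C, (f c).comp ⟨Subtype.val, continuous_subtype_val⟩ * y c)
    (sum_mem fun c hc => mul_mem (restrict_mem_entireClosure (hf c)) (hyS c hc)) (half_pos hε)
  refine ⟨F, hF, fun c hc z hz => ?_⟩
  have hzK : z ∈ K := Set.mem_biUnion hc hz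
  have h1 := hFz ⟨z, hzK⟩
  have h2 : ‖(∑ c' ∈ C, (f c').comp ⟨Subtype.val, continuous_subtype_val⟩ * y c' : C(K, ℂ))
      ⟨z, hzK⟩ - f c z‖ ≤ C.card * (B * η) := by
    have h3 : (∑ c' ∈ C, (f c').comp ⟨Subtype.val, continuous_subtype_val⟩ * y c' : C(K, ℂ))
        ⟨z, hzK⟩ - f c z =
        ∑ c' ∈ C, f c' z * (y c' ⟨z, hzK⟩ - if c' = c then 1 else 0) := by
      simp [mul_sub, Finset.sum_sub_distrib, hc]
    rw [h3, ← nsmul_eq_mul]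
    refine (norm_sum_le _ _).trans (Finset.sum_le_card_nsmul _ _ _ fun c' hc' => ?_)
    rw [norm_mul]
    refine mul_le_mul (hB c' hc' z hzK) ?_ (norm_nonneg _) hB0
    split_ifs with h
    · subst h
      exact (hy c' hc' ⟨z, hzK⟩).1 hz
    · rw [sub_zero]
      refine (hy c' hc' ⟨z, hzK⟩).2 fun hz' => h ?_
      by_contra hne
      have h4 : L ≤ dist c' c := hC hc' hc hne
      have h5 := dist_triangle_left c' c z
      rw [Metric.mem_closedBall] at hz
      have h6 : dist z c' ≤ ρ := hz'
      linarith
  calc ‖F z - f c z‖ ≤ _ := norm_sub_le_norm_sub_add_norm_sub _ _ _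
    _ < ε / 2 + ε / 2 := add_lt_add_of_lt_of_le h1 (h2.trans hsmall.le)
    _ = ε := add_halves ε

/-! ### Covering the sector -/

theorem norm_exp_two_pi_sub (s t : ℝ) :
    ‖Complex.exp (2 * Real.pi * Complex.I * s) - Complex.exp (2 * Real.pi * Complex.I * t)‖ =
      2 * |Real.sin (Real.pi * (s - t))| := by
  have h : Complex.exp (2 * Real.pi * Complex.I * s) - Complex.exp (2 * Real.pi * Complex.I * t) =
      Complex.exp ((2 * Real.pi * t : ℝ) * Complex.I) *
        (Complex.exp (Complex.I * (2 * (Real.pi * (s - t)) : ℝ)) - 1) := by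
    rw [mul_sub, ← Complex.exp_add]
    push_cast
    ring_nf
  rw [h, norm_mul, Complex.norm_exp_ofReal_mul_I, Complex.norm_exp_I_mul_ofReal_sub_one]
  simp

theorem norm_exp_two_pi_sub_le (s t : ℝ) :
    ‖Complex.exp (2 * Real.pi * Complex.I * s) - Complex.exp (2 * Real.pi * Complex.I * t)‖ ≤
      2 * Real.pi * |s - t| := by
  rw [norm_exp_two_pi_sub]
  have := Real.abs_sin_le_abs (x := Real.pi * (s - t))
  rw [abs_mul, abs_of_pos Real.pi_pos] at this
  linarith

theorem le_norm_exp_two_pi_sub {s t : ℝ} (h : |s - t| ≤ 1 / 2) :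
    4 * |s - t| ≤ ‖Complex.exp (2 * Real.pi * Complex.I * s) -
      Complex.exp (2 * Real.pi * Complex.I * t)‖ := by
  rw [norm_exp_two_pi_sub]
  have hpi := Real.pi_pos
  have h1 : |Real.pi * (s - t)| = Real.pi * |s - t| := by rw [abs_mul, abs_of_pos hpi]
  have := Real.mul_abs_le_abs_sin (x := Real.pi * (s - t)) (by rw [h1]; nlinarith)
  rw [h1] at this
  have h2 : 2 / Real.pi * (Real.pi * |s - t|) = 2 * |s - t| := by field_simp
  linarith

theorem norm_exp_two_pi (t : ℝ) : ‖Complex.exp (2 * Real.pi * Complex.I * t)‖ = 1 := by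
  have : 2 * Real.pi * Complex.I * t = (2 * Real.pi * t : ℝ) * Complex.I := by push_cast; ring
  rw [this, Complex.norm_exp_ofReal_mul_I]

/-- Radii growing to infinity, whose increments are positive only across blocks of length `q` on
which `ν` at most doubles, and are there at most `c / ν`. -/
theorem exists_radii {ν : ℕ → ℝ} (hpos : ∀ n, 0 < ν n) (hmono : Monotone ν)
    (hdiv : Tendsto (fun N => ∑ n ∈ Finset.range N, 1 / ν n) atTop atTop)
    {q : ℕ} (hq : 0 < q) {c : ℝ} (hc : 0 < c) (r : ℝ) :
    ∃ ρ : ℕ → ℝ, ρ 0 = r ∧ Monotone ρ ∧ Tendsto ρ atTop atTop ∧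
      ∀ k, ρ k < ρ (k + 1) → ν ((k + 1) * q) ≤ 2 * ν (k * q) ∧
        ρ (k + 1) - ρ k ≤ c / ν ((k + 1) * q) := by
  set u : ℕ → ℝ := fun k => 1 / ν (k * q) with hu
  have hupos : ∀ k, 0 < u k := fun k => one_div_pos.2 (hpos _)
  have hanti : ∀ k, u (k + 1) ≤ u k := fun k =>
    one_div_le_one_div_of_le (hpos _) (hmono (Nat.mul_le_mul_right q k.le_succ))
  -- Positive exactly when `ν` less than doubles across the block, and at most `u (k + 1)`. Without
  -- the `max`, the sum telescopes to `∑ u` plus boundary terms, so it still diverges.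
  set d : ℕ → ℝ := fun k => max 0 (2 * u (k + 1) - u k) with hd
  set ρ : ℕ → ℝ := fun k => r + c * ∑ i ∈ Finset.range k, d i with hρ
  have hstep : ∀ k, ρ (k + 1) = ρ k + c * d k := fun k => by
    simp only [hρ, Finset.sum_range_succ]; ring
  have hd0 : ∀ k, 0 ≤ d k := fun k => le_max_left _ _
  have hsum : ∀ k, ∑ i ∈ Finset.range k, u i - 2 * u 0 + 2 * u k ≤ ∑ i ∈ Finset.range k, d i := by
    intro k
    induction k with
    | zero => simp
    | succ k ih =>
      rw [Finset.sum_range_succ, Finset.sum_range_succ]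
      have : 2 * u (k + 1) - u k ≤ d k := le_max_right _ _
      linarith
  have hblock : ∀ k, ∑ n ∈ Finset.range (k * q), 1 / ν n ≤ q * ∑ i ∈ Finset.range k, u i := by
    intro k
    induction k with
    | zero => simp
    | succ k ih =>
      rw [Nat.succ_mul, Finset.sum_range_add, Finset.sum_range_succ, mul_add]
      refine add_le_add ih ?_
      have : ∀ x ∈ Finset.range q, 1 / ν (k * q + x) ≤ u k := fun x _ =>
        one_div_le_one_div_of_le (hpos _) (hmono (Nat.le_add_right _ _))
      simpa using Finset.sum_le_card_nsmul _ _ _ this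
  have hq' : (0 : ℝ) < q := Nat.cast_pos.2 hq
  refine ⟨ρ, by simp [hρ], monotone_nat_of_le_succ fun k => ?_, ?_, fun k hk => ?_⟩
  · rw [hstep]
    have := mul_nonneg hc.le (hd0 k)
    linarith
  · have h1 : Tendsto (fun k : ℕ => k * q) atTop atTop :=
      tendsto_id.atTop_mul_const' hq
    have h2 : Tendsto (fun k : ℕ => (r - c * (2 * u 0)) +
        (c / q) * ∑ n ∈ Finset.range (k * q), 1 / ν n) atTop atTop :=
      tendsto_atTop_add_const_left _ _ ((hdiv.comp h1).const_mul_atTop (by positivity))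
    refine tendsto_atTop_mono (fun k => ?_) h2
    have h3 : (c / q) * ∑ n ∈ Finset.range (k * q), 1 / ν n ≤ c * ∑ i ∈ Finset.range k, u i := by
      rw [div_mul_eq_mul_div, div_le_iff₀ hq']
      nlinarith [mul_le_mul_of_nonneg_left (hblock k) hc.le]
    have h4 := mul_le_mul_of_nonneg_left (hsum k) hc.le
    have h5 := mul_pos hc (hupos k)
    simp only [hρ]
    nlinarith
  · have h1 : 0 < d k := by
      rw [hstep] at hk
      exact pos_of_mul_pos_right (by linarith) hc.le
    have h2 : d k = 2 * u (k + 1) - u k := by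
      rcases max_choice 0 (2 * u (k + 1) - u k) with h | h
      · exact absurd h h1.ne'
      · exact h
    have h3 := hanti k
    constructor
    · have h4 : u k < 2 * u (k + 1) := by linarith
      simp only [hu] at h4
      rw [← mul_div_assoc, div_lt_div_iff₀ (hpos _) (hpos _)] at h4
      linarith
    · rw [hstep, div_eq_mul_one_div]
      have : d k ≤ u (k + 1) := by linarith
      have := mul_le_mul_of_nonneg_left this hc.le
      simp only [hu] at this
      linarith

theorem ConditionSigma.exists_subsequence {l : ℕ → ℂ} (hl : ConditionSigma l)
    (hlim : Tendsto (fun n => ‖l n‖) atTop atTop) {M : ℝ} (hM : 0 < M) :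
    ∃ φ : ℕ → ℕ, (∀ n, M ≤ ‖l (φ n)‖) ∧
      (∀ m n, m < n → M ≤ ‖l (φ n)‖ - ‖l (φ m)‖) ∧
      Tendsto (fun N => ∑ n ∈ Finset.range N, 1 / ‖l (φ n)‖) atTop atTop := by
  obtain ⟨φ, hφ, hgap, hdiv⟩ := hl M hM
  obtain ⟨n₀, hn₀⟩ := ((hlim.comp hφ.tendsto_atTop).eventually_ge_atTop M).exists_forall_of_atTop
  refine ⟨fun n => φ (n₀ + n), fun n => hn₀ _ (Nat.le_add_right _ _), fun m n hmn => ?_, ?_⟩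
  · have hmono : Monotone fun n => ‖l (φ (n₀ + n))‖ :=
      monotone_nat_of_le_succ fun k => by
        have := hgap (n₀ + k)
        rw [← add_assoc]
        linarith
    have h1 := hmono (Nat.succ_le_of_lt hmn)
    have h2 := hgap (n₀ + m)
    simp only [Nat.succ_eq_add_one, ← add_assoc] at h1
    linarith
  · have h1 : ∀ N, ∑ n ∈ Finset.range N, 1 / ‖l (φ (n₀ + n))‖ =
        -(∑ n ∈ Finset.range n₀, 1 / ‖l (φ n)‖) +
          ∑ n ∈ Finset.range (n₀ + N), 1 / ‖l (φ n)‖ := fun N => by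
      rw [Finset.sum_range_add]; ring
    simp only [h1]
    refine tendsto_atTop_add_const_left _ _ (hdiv.comp ?_)
    exact tendsto_atTop_mono (fun N => Nat.le_add_left N n₀) tendsto_id

/-- Finitely many `c` and indices `n` such that the discs of radius `δ / ‖l n‖` around `c` cover
the sector, while the points `l n * c` are `L`-separated from each other and from the origin. -/
theorem exists_sector_cover {l : ℕ → ℂ} (hl : ConditionSigma l)
    (hlim : Tendsto (fun n => ‖l n‖) atTop atTop) {r₀ R₀ θ₀ θT : ℝ} (hr₀ : 0 < r₀)
    (hrR : r₀ < R₀) (hθ : θ₀ ≤ θT) (hdiff : θT - θ₀ ≤ 1 / 2) {L δ : ℝ} (hL : 0 < L) (hδ : 0 < δ) :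
    ∃ P : Finset (ℕ × ℂ), (∀ p ∈ P, L ≤ ‖l p.1 * p.2‖) ∧
      (∀ p ∈ P, ∀ p' ∈ P, p ≠ p' → L ≤ dist (l p.1 * p.2) (l p'.1 * p'.2)) ∧
      ∀ a ∈ sector r₀ R₀ θ₀ θT, ∃ p ∈ P, ‖l p.1‖ * ‖a - p.2‖ ≤ δ := by
  have hR₀ : 0 < R₀ := hr₀.trans hrR
  obtain ⟨φ, hM, hgap, hdiv⟩ := hl.exists_subsequence hlim (div_pos hL hr₀)
  set ν : ℕ → ℝ := fun n => ‖l (φ n)‖ with hν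
  have hMpos : 0 < L / r₀ := div_pos hL hr₀
  have hpos : ∀ n, 0 < ν n := fun n => hMpos.trans_le (hM n)
  have hmono : Monotone ν := monotone_nat_of_le_succ fun n => by
    have := hgap n (n + 1) n.lt_succ_self
    simp only [hν]
    linarith
  -- Large enough that one angular step `τ k`, scaled by `2 * ν (k * q)`, moves a point of modulus
  -- at most `R₀` by at most `δ / 2`.
  obtain ⟨q, hq1⟩ := exists_nat_ge (2 * Real.pi * R₀ * L / (r₀ * δ))
  have hq' : (0 : ℝ) < q := lt_of_lt_of_le (by positivity) hq1
  have hq : 0 < q := Nat.cast_pos.1 hq'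
  obtain ⟨ρ, hρ0, hρmono, hρlim, hρstep⟩ := exists_radii hpos hmono hdiv hq (half_pos hδ) r₀
  obtain ⟨K, hKR⟩ := (hρlim.eventually_gt_atTop R₀).exists
  have hρr : ∀ k, r₀ ≤ ρ k := fun k => hρ0 ▸ hρmono (Nat.zero_le k)
  -- An index recurs only after `q` steps; the chord bound `4 * |s - t|` then gives separation at
  -- least `L`.
  set τ : ℕ → ℝ := fun k => L / (4 * r₀ * q * ν (k * q)) with hτ
  have hτpos : ∀ k, 0 < τ k := fun k => by have := hpos (k * q); positivity
  set pt : ℕ → ℕ → ℕ × ℂ := fun k m => (φ (k * q + m % q),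
    (ρ k : ℂ) * Complex.exp (2 * Real.pi * Complex.I * (θ₀ + m * τ k : ℝ))) with hpt
  set P : Finset (ℕ × ℂ) := (Finset.range K).biUnion fun k =>
    (Finset.range (⌊(θT - θ₀) / τ k⌋₊ + 1)).image (pt k) with hP
  have hnorm : ∀ k m, ‖l (pt k m).1 * (pt k m).2‖ = ν (k * q + m % q) * ρ k := fun k m => by
    simp only [hpt, norm_mul, norm_exp_two_pi, mul_one, Complex.norm_real, Real.norm_eq_abs,
      abs_of_pos (hr₀.trans_le (hρr k)), hν]
  have hinj : ∀ k m k' m', k * q + m % q = k' * q + m' % q → k = k' := fun k m k' m' h => by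
    have h1 := congrArg (· / q) h
    simpa [Nat.mul_add_div, Nat.add_mul_div_right, hq, mul_comm _ q,
      Nat.div_eq_of_lt (Nat.mod_lt _ hq)] using h1
  have hlt : ∀ k m k' m', k * q + m % q < k' * q + m' % q →
      L ≤ dist (l (pt k m).1 * (pt k m).2) (l (pt k' m').1 * (pt k' m').2) := by
    intro k m k' m' h
    have hk : k ≤ k' := by
      by_contra! hk
      have h1 := Nat.mul_le_mul_right q (Nat.succ_le_of_lt hk)
      have h2 := Nat.mod_lt m' hq
      rw [Nat.succ_mul] at h1
      omega
    -- Distinct indices are separated by modulus alone: the gaps of `ν` are at least `L / r₀` and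
    -- the radii do not decrease.
    have h1 : L ≤ r₀ * (ν (k' * q + m' % q) - ν (k * q + m % q)) := by
      have := hgap _ _ h
      rw [div_le_iff₀' hr₀] at this
      exact this
    have h2 : ‖l (pt k' m').1 * (pt k' m').2‖ - ‖l (pt k m).1 * (pt k m).2‖ ≤
        dist (l (pt k m).1 * (pt k m).2) (l (pt k' m').1 * (pt k' m').2) := by
      rw [dist_comm, dist_eq_norm]
      exact norm_sub_norm_le _ _
    rw [hnorm, hnorm] at h2
    have h3 := mul_le_mul_of_nonneg_left (hρmono hk) (hpos (k' * q + m' % q)).le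
    have h4 := mul_le_mul_of_nonneg_right (hρr k)
      (sub_nonneg.2 (hmono h.le))
    nlinarith
  have hang : ∀ k m m' : ℕ, m * τ k ≤ θT - θ₀ → m' < m → m % q = m' % q →
      L ≤ dist (l (pt k m).1 * (pt k m).2) (l (pt k m').1 * (pt k m').2) := by
    intro k m m' hm hmm hmod
    have h1 : m' + q ≤ m := by
      have h2 := Nat.div_add_mod m q
      have h3 := Nat.div_add_mod m' q
      have h4 : m' / q < m / q := by
        by_contra! h5
        have := Nat.mul_le_mul_left q h5
        omega
      have := Nat.mul_le_mul_left q (Nat.succ_le_of_lt h4)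
      rw [Nat.mul_succ] at this
      omega
    have h1' : (m' : ℝ) + q ≤ m := by exact_mod_cast h1
    have hm0 : (0 : ℝ) ≤ m' := Nat.cast_nonneg _
    have h2 : |(θ₀ + m * τ k) - (θ₀ + m' * τ k)| = (m - m') * τ k := by
      rw [abs_of_nonneg] <;> nlinarith [hτpos k]
    have h3 := le_norm_exp_two_pi_sub (s := θ₀ + m * τ k) (t := θ₀ + m' * τ k)
      (by rw [h2]; nlinarith [hτpos k])
    rw [h2] at h3
    have h4 : dist (l (pt k m).1 * (pt k m).2) (l (pt k m').1 * (pt k m').2) =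
        ν (k * q + m % q) * ρ k * ‖Complex.exp (2 * Real.pi * Complex.I * (θ₀ + m * τ k : ℝ)) -
          Complex.exp (2 * Real.pi * Complex.I * (θ₀ + m' * τ k : ℝ))‖ := by
      rw [dist_eq_norm]
      simp only [hpt, ← hmod]
      rw [← mul_sub, ← mul_sub, norm_mul, norm_mul, Complex.norm_real, Real.norm_eq_abs,
        abs_of_pos (hr₀.trans_le (hρr k))]
      exact (mul_assoc _ _ _).symm
    have h5 : 4 * (q * τ k) ≤ 4 * ((m - m') * τ k) := by nlinarith [hτpos k]
    have h6 : L = ν (k * q) * r₀ * (4 * (q * τ k)) := by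
      have := (hpos (k * q)).ne'
      simp only [hτ]
      field_simp
    rw [h4, h6]
    have h7 : ν (k * q) ≤ ν (k * q + m % q) := hmono (Nat.le_add_right _ _)
    have h8 := hτpos k
    have h9 := (hpos (k * q)).le
    have h10 := (hpos (k * q + m % q)).le
    have h11 := hρr k
    have h12 : 0 ≤ ρ k := hr₀.le.trans h11
    exact mul_le_mul (mul_le_mul h7 h11 hr₀.le h10) (h5.trans h3) (by positivity)
      (mul_nonneg h10 h12)
  have hmemP : ∀ p ∈ P, ∃ k m : ℕ, m * τ k ≤ θT - θ₀ ∧ pt k m = p := by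
    intro p hp
    simp only [hP, Finset.mem_biUnion, Finset.mem_image, Finset.mem_range] at hp
    obtain ⟨k, -, m, hm, rfl⟩ := hp
    refine ⟨k, m, ?_, rfl⟩
    rw [← le_div_iff₀ (hτpos k)]
    exact (Nat.cast_le.2 (Nat.lt_succ_iff.1 hm)).trans
      (Nat.floor_le (div_nonneg (sub_nonneg.2 hθ) (hτpos k).le))
  refine ⟨P, fun p hp => ?_, fun p hp p' hp' hne => ?_, ?_⟩
  · obtain ⟨k, m, -, rfl⟩ := hmemP p hp
    rw [hnorm]
    have h1 := hM (k * q + m % q)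
    rw [div_le_iff₀ hr₀] at h1
    exact h1.trans (mul_le_mul_of_nonneg_left (hρr k) (hpos _).le)
  · obtain ⟨k, m, hm, rfl⟩ := hmemP p hp
    obtain ⟨k', m', hm', rfl⟩ := hmemP p' hp'
    rcases lt_trichotomy (k * q + m % q) (k' * q + m' % q) with h | h | h
    · exact hlt _ _ _ _ h
    · obtain rfl := hinj _ _ _ _ h
      have hmod := Nat.add_left_cancel h
      rcases lt_trichotomy m m' with h' | rfl | h'
      · rw [dist_comm]
        exact hang _ _ _ hm' h' hmod.symm
      · exact absurd rfl hne
      · exact hang _ _ _ hm h' hmod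
    · rw [dist_comm]
      exact hlt _ _ _ _ h
  · rintro _ ⟨r, ⟨hr1, hr2⟩, t, ⟨ht1, ht2⟩, rfl⟩
    -- The first radius beyond `r` gives `ρ k ≤ r < ρ (k + 1)`: a genuine increase, so the doubling
    -- bound holds on this block. Radial and angular errors get `δ / 2` each.
    have hex : ∃ j, r < ρ j := ⟨K, hr2.trans_lt hKR⟩
    obtain ⟨k, hk⟩ : ∃ k, Nat.find hex = k + 1 := by
      refine Nat.exists_eq_succ_of_ne_zero fun h0 => ?_
      have := Nat.find_spec hex
      rw [h0, hρ0] at this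
      linarith
    have hrk : r < ρ (k + 1) := hk ▸ Nat.find_spec hex
    have hkr : ρ k ≤ r := not_lt.1 (Nat.find_min hex (by omega))
    have hkK : k < K := by
      have := Nat.find_min' hex (hr2.trans_lt hKR)
      omega
    obtain ⟨hdouble, hinc⟩ := hρstep k (hkr.trans_lt hrk)
    have htτ : 0 ≤ (t - θ₀) / τ k := div_nonneg (sub_nonneg.2 ht1) (hτpos k).le
    set m := ⌊(t - θ₀) / τ k⌋₊ with hm
    have hm1 : m * τ k ≤ t - θ₀ := (le_div_iff₀ (hτpos k)).1 (Nat.floor_le htτ)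
    have hm2 : t - θ₀ < (m + 1) * τ k := (div_lt_iff₀ (hτpos k)).1 (Nat.lt_floor_add_one _)
    refine ⟨pt k m, ?_, ?_⟩
    · simp only [hP, Finset.mem_biUnion, Finset.mem_image, Finset.mem_range]
      refine ⟨k, hkK, m, Nat.lt_succ_of_le (Nat.floor_le_floor ?_), rfl⟩
      have := (hτpos k).le
      gcongr
    · have hν1 : ν (k * q + m % q) ≤ ν ((k + 1) * q) := hmono (by
        have := Nat.mod_lt m hq
        rw [Nat.succ_mul]
        omega)
      set s : ℝ := θ₀ + m * τ k with hs
      have h1 : (r : ℂ) * Complex.exp (2 * Real.pi * Complex.I * t) - (pt k m).2 =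
          ((r - ρ k : ℝ) : ℂ) * Complex.exp (2 * Real.pi * Complex.I * s) +
            r * (Complex.exp (2 * Real.pi * Complex.I * t) -
              Complex.exp (2 * Real.pi * Complex.I * s)) := by
        simp only [hpt, hs]
        push_cast
        ring
      have hr0 : 0 ≤ r := hr₀.le.trans hr1
      have h2 : ‖(r : ℂ) * Complex.exp (2 * Real.pi * Complex.I * t) - (pt k m).2‖ ≤
          (r - ρ k) + R₀ * (2 * Real.pi * τ k) := by
        rw [h1]
        refine (norm_add_le _ _).trans (add_le_add ?_ ?_)
        · rw [norm_mul, norm_exp_two_pi, Complex.norm_real, mul_one, Real.norm_eq_abs,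
            abs_of_nonneg (sub_nonneg.2 hkr)]
        · rw [norm_mul, Complex.norm_real, Real.norm_eq_abs, abs_of_nonneg hr0]
          refine mul_le_mul hr2 ((norm_exp_two_pi_sub_le t s).trans ?_) (norm_nonneg _) hR₀.le
          refine mul_le_mul_of_nonneg_left ?_ (by positivity)
          rw [abs_of_nonneg (by linarith)]
          linarith
      have h3 : ν (k * q + m % q) * (r - ρ k) ≤ δ / 2 := by
        refine (mul_le_mul hν1 (show r - ρ k ≤ δ / 2 / ν ((k + 1) * q) by linarith)
          (sub_nonneg.2 hkr) (hpos _).le).trans_eq ?_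
        exact mul_div_cancel₀ _ (hpos _).ne'
      have h4 : ν (k * q + m % q) * (R₀ * (2 * Real.pi * τ k)) ≤ δ / 2 := by
        have h5 := hτpos k
        refine (mul_le_mul_of_nonneg_right (hν1.trans hdouble) (by positivity)).trans ?_
        have h6 : 2 * ν (k * q) * (R₀ * (2 * Real.pi * τ k)) =
            (2 * Real.pi * R₀ * L / (r₀ * δ)) * (δ / 2) / q := by
          have := (hpos (k * q)).ne'
          simp only [hτ]
          field_simp
          ring
        rw [h6, div_le_iff₀ hq', mul_comm (δ / 2)]
        exact mul_le_mul_of_nonneg_right hq1 (by positivity)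
      calc ‖l (pt k m).1‖ * _ ≤ ν (k * q + m % q) * ((r - ρ k) + R₀ * (2 * Real.pi * τ k)) :=
            mul_le_mul_of_nonneg_left h2 (norm_nonneg _)
        _ ≤ δ := by rw [mul_add]; linarith

/-! ### Baire category reduction -/

theorem isClosed_entireFunctions : IsClosed (entireFunctions : Set C(ℂ, ℂ)) := by
  refine isClosed_of_closure_subset fun f hf => ?_
  obtain ⟨u, hu, hlim⟩ := mem_closure_iff_seq_limit.1 hf
  have h := ContinuousMap.tendsto_iff_tendstoLocallyUniformly.1 hlim
  exact differentiableOn_univ.1 ((tendstoLocallyUniformlyOn_univ.2 h).differentiableOn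
    (Eventually.of_forall fun n => (hu n : Differentiable ℂ (u n)).differentiableOn) isOpen_univ)

theorem baireSpace_entireFunctions : BaireSpace entireFunctions := by
  have : CompleteSpace entireFunctions := isClosed_entireFunctions.completeSpace_coe
  have : (uniformity entireFunctions).IsCountablyGenerated :=
    Filter.comap.isCountablyGenerated (uniformity C(ℂ, ℂ)) _
  have : TopologicalSpace.PseudoMetrizableSpace entireFunctions :=
    UniformSpace.pseudoMetrizableSpace
  infer_instance

theorem isCompact_sector (r₀ R₀ θ₀ θT : ℝ) : IsCompact (sector r₀ R₀ θ₀ θT) := by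
  have h : sector r₀ R₀ θ₀ θT =
      (fun p : ℝ × ℝ => (p.1 : ℂ) * Complex.exp (2 * Real.pi * Complex.I * p.2)) ''
        (Set.Icc r₀ R₀ ×ˢ Set.Icc θ₀ θT) := by
    ext a
    constructor
    · rintro ⟨r, hr, t, ht, rfl⟩
      exact ⟨(r, t), ⟨hr, ht⟩, rfl⟩
    · rintro ⟨⟨r, t⟩, ⟨hr, ht⟩, rfl⟩
      exact ⟨r, hr, t, ht, rfl⟩
  rw [h]
  exact (isCompact_Icc.prod isCompact_Icc).image (by fun_prop)

theorem continuous_translation_uncurry :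
    Continuous fun p : entireFunctions × ℂ => translation p.2 p.1 := by
  refine Continuous.subtype_mk ?_ _
  have h : Continuous fun a : ℂ => (⟨fun z => z + a, by fun_prop⟩ : C(ℂ, ℂ)) :=
    ContinuousMap.continuous_of_continuous_uncurry _ (by
      simp only [Function.uncurry_def, ContinuousMap.coe_mk]; fun_prop)
  exact ContinuousMap.continuous_comp'.comp
    ((h.comp continuous_snd).prodMk (continuous_subtype_val.comp continuous_fst))

/-- The functions some translate of which, for each `a ∈ S`, lies in `U`. -/
def hittingSet (l : ℕ → ℂ) (S : Set ℂ) (U : Set entireFunctions) : Set entireFunctions :=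
  {f | ∀ a ∈ S, ∃ n, translation (l n * a) f ∈ U}

theorem isOpen_hittingSet (l : ℕ → ℂ) {S : Set ℂ} (hS : IsCompact S) {U : Set entireFunctions}
    (hU : IsOpen U) : IsOpen (hittingSet l S U) := by
  rw [isOpen_iff_mem_nhds]
  intro f hf
  refine hS.eventually_forall_of_forall_eventually
    (P := fun f a => ∃ n, translation (l n * a) f ∈ U) fun a ha => ?_
  obtain ⟨n, hn⟩ := hf a ha
  have hc : Continuous fun p : entireFunctions × ℂ => translation (l n * p.2) p.1 :=
    continuous_translation_uncurry.comp
      (continuous_fst.prodMk (continuous_const.mul continuous_snd))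
  filter_upwards [(hU.preimage hc).mem_nhds hn] with p hp using ⟨n, hp⟩

theorem iInter_hypercyclicVectors_eq (l : ℕ → ℂ) (S : Set ℂ) {B : Set (Set entireFunctions)}
    (hB : TopologicalSpace.IsTopologicalBasis B) (hne : ∀ U ∈ B, U.Nonempty) :
    (⋂ a ∈ S, hypercyclicVectors fun n => translation (l n * a)) =
      ⋂ U ∈ B, hittingSet l S U := by
  ext f
  simp only [hypercyclicVectors, hittingSet, Set.mem_iInter, Set.mem_ofPred_eq, hB.dense_iff]
  constructor
  · intro h U hU a ha
    obtain ⟨_, h1, n, rfl⟩ := h a ha U hU (hne U hU)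
    exact ⟨n, h1⟩
  · intro h a ha U hU _
    obtain ⟨n, hn⟩ := h U hU a ha
    exact ⟨_, hn, n, rfl⟩

theorem exists_closedBall_approx_subset {V : Set entireFunctions} (hV : IsOpen V)
    {g : entireFunctions} (hg : g ∈ V) :
    ∃ R : ℝ, ∃ ε : ℝ, 0 < ε ∧ ∀ h : entireFunctions,
      (∀ z : ℂ, ‖z‖ ≤ R → ‖(h : C(ℂ, ℂ)) z - (g : C(ℂ, ℂ)) z‖ < ε) → h ∈ V := by
  obtain ⟨W, hW, rfl⟩ := isOpen_induced_iff.1 hV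
  have hb := nhds_basis_uniformity'
    (Metric.uniformity_basis_dist.compactConvergenceUniformity (α := ℂ) (β := ℂ))
    (x := (g : C(ℂ, ℂ)))
  obtain ⟨⟨K, ε⟩, ⟨hK, hε⟩, hsub⟩ := hb.mem_iff.1 (hW.mem_nhds hg)
  obtain ⟨R, hR⟩ := hK.isBounded.subset_closedBall 0
  refine ⟨R, ε, hε, fun h hh => hsub fun z hz => ?_⟩
  have := hh z (by simpa using hR hz)
  rw [← dist_eq_norm, dist_comm] at this
  exact this

/-! ### Density and conclusion -/

theorem dense_hittingSet_sector {l : ℕ → ℂ} (hl : ConditionSigma l)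
    (hlim : Tendsto (fun n => ‖l n‖) atTop atTop) {r₀ R₀ θ₀ θT : ℝ} (hr₀ : 0 < r₀)
    (hrR : r₀ < R₀) (hθ : θ₀ ≤ θT) (hdiff : θT - θ₀ ≤ 1 / 2) {U : Set entireFunctions}
    (hU : IsOpen U) (hne : U.Nonempty) : Dense (hittingSet l (sector r₀ R₀ θ₀ θT) U) := by
  rw [dense_iff_inter_open]
  rintro V hV ⟨g, hg⟩
  obtain ⟨p, hp⟩ := hne
  obtain ⟨R₁, ε₁, hε₁, hVg⟩ := exists_closedBall_approx_subset hV hg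
  obtain ⟨R₂, ε₂, hε₂, hUp⟩ := exists_closedBall_approx_subset hU hp
  set R := max 0 (max R₁ R₂) with hR
  have hR0 : 0 ≤ R := le_max_left _ _
  have hR1 : R₁ ≤ R := (le_max_left _ _).trans (le_max_right _ _)
  have hR2 : R₂ ≤ R := (le_max_right _ _).trans (le_max_right _ _)
  set ε := min ε₁ (ε₂ / 2) with hε
  have hε0 : 0 < ε := lt_min hε₁ (half_pos hε₂)
  have huc : UniformContinuousOn (p : C(ℂ, ℂ)) (Metric.closedBall 0 (R + 1)) :=
    (isCompact_closedBall _ _).uniformContinuousOn_of_continuous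
      (p : C(ℂ, ℂ)).continuous.continuousOn
  obtain ⟨δ', hδ', huc⟩ := Metric.uniformContinuousOn_iff.1 huc (ε₂ / 2) (half_pos hε₂)
  set δ := min 1 (δ' / 2) with hδ
  have hδ0 : 0 < δ := lt_min one_pos (half_pos hδ')
  have hδ1 : δ ≤ 1 := min_le_left _ _
  have hδ2 : δ < δ' := (min_le_right _ _).trans_lt (half_lt_self hδ')
  -- Discs of radius `R + 1` leave room for the displacement `δ ≤ 1`; their centres are kept `2 * (R
  -- + 1) + 1` apart.
  have hL : 2 * (R + 1) < 2 * (R + 1) + 1 := by linarith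
  have hL0 : 0 < 2 * (R + 1) + 1 := by linarith
  obtain ⟨P, hP0, hPsep, hPcov⟩ := exists_sector_cover hl hlim hr₀ hrR hθ hdiff hL0 hδ0
  set C : Finset ℂ := insert 0 (P.image fun x => l x.1 * x.2) with hC
  have hCsep : (C : Set ℂ).Pairwise fun c c' => 2 * (R + 1) + 1 ≤ dist c c' := by
    have : Std.Symm fun c c' : ℂ => 2 * (R + 1) + 1 ≤ dist c c' :=
      ⟨fun a b h => by rwa [dist_comm]⟩
    rw [hC, Finset.coe_insert, Set.pairwise_insert_of_symm]
    constructor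
    · intro c hc c' hc' hne
      simp only [Finset.coe_image, Set.mem_image, Finset.mem_coe] at hc hc'
      obtain ⟨x, hx, rfl⟩ := hc
      obtain ⟨x', hx', rfl⟩ := hc'
      exact hPsep x hx x' hx' (by rintro rfl; exact hne rfl)
    · intro c hc _
      simp only [Finset.coe_image, Set.mem_image, Finset.mem_coe] at hc
      obtain ⟨x, hx, rfl⟩ := hc
      rw [dist_zero_left]
      exact hP0 x hx
  obtain ⟨F, hF, hFC⟩ := exists_entire_approx_on_discs (by linarith : 0 < R + 1) hL hCsep
    -- The disc at 0 keeps the function in `V`; each other disc carries a copy of `p` centred there.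
    (fun c => if c = 0 then (g : C(ℂ, ℂ)) else (translation (-c) p : C(ℂ, ℂ)))
    (fun c => by
      split_ifs
      · exact g.2
      · exact (translation (-c) p).2) hε0
  refine ⟨⟨F, hF⟩, hVg _ fun z hz => ?_, fun a ha => ?_⟩
  · have := hFC 0 (Finset.mem_insert_self _ _) z (by simp; linarith)
    rw [if_pos rfl] at this
    exact this.trans_le (min_le_left _ _)
  · obtain ⟨x, hx, hax⟩ := hPcov a ha
    refine ⟨x.1, hUp _ fun z hz => ?_⟩
    have hx0 : l x.1 * x.2 ≠ 0 := by
      intro h0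
      have := hP0 x hx
      rw [h0, norm_zero] at this
      linarith
    set w := z + l x.1 * a with hw
    have hzw : w + -(l x.1 * x.2) - z = l x.1 * (a - x.2) := by rw [hw]; ring
    have hd : ‖w + -(l x.1 * x.2) - z‖ ≤ δ := by rw [hzw, norm_mul]; exact hax
    have hn : ‖w + -(l x.1 * x.2)‖ ≤ R + 1 := by
      have := norm_sub_norm_le (w + -(l x.1 * x.2)) z
      linarith
    have h1 := hFC (l x.1 * x.2)
      (Finset.mem_insert_of_mem (Finset.mem_image_of_mem (fun x : ℕ × ℂ => l x.1 * x.2) hx)) w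
      (by rw [Metric.mem_closedBall, dist_eq_norm, sub_eq_add_neg]; exact hn)
    rw [if_neg hx0, translation_apply] at h1
    have h2 := huc (w + -(l x.1 * x.2)) (by simpa using hn) z
      (by rw [mem_closedBall_zero_iff]; linarith) (by rw [dist_eq_norm]; linarith)
    rw [dist_eq_norm] at h2
    have h3 : ε ≤ ε₂ / 2 := min_le_right _ _
    calc ‖F w - (p : C(ℂ, ℂ)) z‖ ≤ _ := norm_sub_le_norm_sub_add_norm_sub _ _ _
      _ < ε₂ / 2 + ε₂ / 2 := add_lt_add (h1.trans_le h3) h2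
      _ = ε₂ := add_halves _

theorem proposition2p1 (l : ℕ → ℂ) (hl0 : ∀ n, l n ≠ 0)
    (hlim : Tendsto (fun n => ‖l n‖) atTop atTop) (hl : ConditionSigma l)
    (r₀ R₀ θ₀ θT : ℝ) (hr₀ : 0 < r₀) (hr₀1 : r₀ < 1) (hR₀ : 1 < R₀)
    (hθ₀ : 0 ≤ θ₀) (hθ : θ₀ < θT) (hθT : θT ≤ 1) (hdiff : θT - θ₀ = 1 / 4) :
    IsGδ (⋂ a ∈ sector r₀ R₀ θ₀ θT, hypercyclicVectors fun n => translation (l n * a)) ∧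
      Dense (⋂ a ∈ sector r₀ R₀ θ₀ θT, hypercyclicVectors fun n => translation (l n * a)) := by
  have : BaireSpace entireFunctions := baireSpace_entireFunctions
  have : SecondCountableTopology entireFunctions :=
    TopologicalSpace.Subtype.secondCountableTopology _
  have hB := TopologicalSpace.isBasis_countableBasis entireFunctions
  have hcount := TopologicalSpace.countable_countableBasis entireFunctions
  have hopen : ∀ U ∈ TopologicalSpace.countableBasis entireFunctions,
      IsOpen (hittingSet l (sector r₀ R₀ θ₀ θT) U) := fun U hU =>
    isOpen_hittingSet l (isCompact_sector _ _ _ _) (hB.isOpen hU)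
  rw [iInter_hypercyclicVectors_eq l _ hB
    fun U hU => TopologicalSpace.nonempty_of_mem_countableBasis hU]
  exact ⟨IsGδ.biInter_of_isOpen hcount hopen, dense_biInter_of_isOpen hopen hcount fun U hU =>
    dense_hittingSet_sector hl hlim hr₀ (hr₀1.trans hR₀) hθ.le (by linarith) (hB.isOpen hU)
      (TopologicalSpace.nonempty_of_mem_countableBasis hU)⟩
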